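/- Conventions. $\mathbb{H}^2$ is a right quaternionic vector space, $\operatorname{End}(\mathbb{H}^2)$ denotes its quaternionic linear endomorphisms, and everything is smooth ($C^\infty$). A Riemann surface is a 2-dimensional smooth manifold $M$ with a smooth complex structure $J:TM\to TM$, $J^2=-1$; for a 1-form $\omega$ on $M$ put $*\omega:=\omega\circ J$. Let $H=M\times\mathbb{H}^2$ be the product bundle, and let $L\subset H$ be a quaternionic line subbundle, i.e. a map $M\to\mathbb{H}P^1$, $p\mapsto L_p$. Its derivative is the 1-form $\delta$ with values in $\operatorname{Hom}(L,H/L)$ given by $$\delta_p(X)\,\psi(p)=d_p\psi(X)\bmod L_p$$ for $p\in M$, $X\in T_pM$ and (local) sections $\psi$ of $L$. The bundle $L$ is a holomorphic curve if there is a smooth section $J_L$ of $\operatorname{End}(L)$ with $J_L^2=-1$ and $*\delta=\delta\circ J_L$; it is immersed if $\delta_p:T_pM\to\operatorname{Hom}(L_p,\mathbb{H}^2/L_p)$ is injective for every $p\in M$. A complex structure on $H$ is a smooth map $S:M\to\operatorname{End}(\mathbb{H}^2)$ with $S^2=-1$; its Hopf field $Q$ is the $\operatorname{End}(\mathbb{H}^2)$-valued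 1-form $$Q=\tfrac14\,(S\,dS-*dS).$$ Theorem. Let $M$ be a Riemann surface and let $L\subset H=M\times\mathbb{H}^2$ be an immersed holomorphic curve in $\mathbb{H}P^1$. Then there exists a unique complex structure $S$ on $H$ such that 1. $SL=L$ and $dS(X)L_p\subset L_p$ for all $p\in M$, $X\in T_pM$; 2. $*\delta=\delta\circ S=S\circ\delta$, where $S$ acts on $L$ by restriction and on $H/L$ by passing to the quotient; 3. $Q|_L=0$, i.e. $Q(X)v=0$ for all $p\in M$, $X\in T_pM$, $v\in L_p$. This $S$ is called the mean curvature sphere (or conformal Gauss map) of $L$. -/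

import Mathlib

open scoped Manifold ContDiff Quaternion MulOpposite Topology

noncomputable section

namespace QuaternionicCurve

/-- The right quaternionic vector space `ℍ²`; right scalar multiplication by `a` is `op a • v`. -/
abbrev H2 : Type := Fin 2 → ℍ[ℝ]

/-- `End(ℍ²)`: the (real) algebra of maps of `ℍ²` that are linear for right multiplication by
quaternions. It is a linear subspace of the finite-dimensional normed space of real linear maps of
`ℍ²`; smoothness and differentials of maps into it are taken there. -/
def EndH : Subalgebra ℝ (H2 →L[ℝ] H2) where
  carrier := {A | ∀ (a : ℍ[ℝ]ᵐᵒᵖ) (v : H2), A (a • v) = a • A v}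
  mul_mem' := by
    intro A B hA hB a v
    simp only [Set.mem_ofPred_eq] at hA hB
    simp [hA, hB]
  add_mem' := by
    intro A B hA hB a v
    simp only [Set.mem_ofPred_eq] at hA hB
    simp [hA, hB]
  algebraMap_mem' := by
    intro r a v
    simp only [Algebra.algebraMap_eq_smul_one, smul_apply,
      one_apply_eq_self]
    exact smul_comm r a v

/-- An element of `End(ℍ²)` as a quaternionic linear map. -/
def toLin (A : EndH) : H2 →ₗ[ℍ[ℝ]ᵐᵒᵖ] H2 where
  toFun v := (A : H2 →L[ℝ] H2) v
  map_add' v w := map_add (A : H2 →L[ℝ] H2) v w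
  map_smul' a v := A.2 a v

/-- A complex structure `J : TM → TM`, `J² = -1`, on a smooth real surface `M`.
A surface with such a structure is a Riemann surface. -/
structure RiemannSurfaceStructure (M : Type*) [TopologicalSpace M]
    [ChartedSpace (EuclideanSpace ℝ (Fin 2)) M] [IsManifold (𝓡 2) ∞ M] where
  J : ∀ p : M, TangentSpace (𝓡 2) p →ₗ[ℝ] TangentSpace (𝓡 2) p
  J_sq : ∀ (p : M) (X : TangentSpace (𝓡 2) p), J p (J p X) = -X
  smooth_J : ContMDiff (𝓡 2).tangent (𝓡 2).tangent ∞
    (fun X : TangentBundle (𝓡 2) M => (⟨X.proj, J X.proj X.snd⟩ : TangentBundle (𝓡 2) M))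

/-- A smooth quaternionic line subbundle of the product bundle `M × ℍ²`, that is, a family of right
quaternionic lines which is locally spanned by a smooth nowhere vanishing section. -/
structure LineSubbundle (M : Type*) [TopologicalSpace M]
    [ChartedSpace (EuclideanSpace ℝ (Fin 2)) M] where
  fiber : M → Submodule ℍ[ℝ]ᵐᵒᵖ H2
  exists_frame : ∀ p : M, ∃ (U : Set M) (φ : M → H2), IsOpen U ∧ p ∈ U ∧
    ContMDiffOn (𝓡 2) 𝓘(ℝ, H2) ∞ φ U ∧
    ∀ q ∈ U, φ q ≠ 0 ∧ fiber q = Submodule.span ℍ[ℝ]ᵐᵒᵖ {φ q}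

variable {M : Type*} [TopologicalSpace M] [ChartedSpace (EuclideanSpace ℝ (Fin 2)) M]

/-- The differential `dψ` of a map `ψ : M → ℍ²`. -/
def dSection (ψ : M → H2) (p : M) : TangentSpace (𝓡 2) p →L[ℝ] H2 :=
  mfderiv (𝓡 2) 𝓘(ℝ, H2) ψ p

/-- The differential `dS` of a map `S : M → End(ℍ²)`. Its values lie in the subspace `End(ℍ²)` of
the real linear maps of `ℍ²`. -/
def dEnd (S : M → EndH) (p : M) : TangentSpace (𝓡 2) p →L[ℝ] (H2 →L[ℝ] H2) :=
  mfderiv (𝓡 2) 𝓘(ℝ, H2 →L[ℝ] H2) (fun q => (S q : H2 →L[ℝ] H2)) p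

theorem hasMFDerivAt_apply {F G : Type*} [NormedAddCommGroup F] [NormedSpace ℝ F]
    [NormedAddCommGroup G] [NormedSpace ℝ G] {A : M → F →L[ℝ] G} {ψ : M → F} {p : M}
    {A' : EuclideanSpace ℝ (Fin 2) →L[ℝ] (F →L[ℝ] G)} {ψ' : EuclideanSpace ℝ (Fin 2) →L[ℝ] F}
    (hA : HasMFDerivAt (𝓡 2) 𝓘(ℝ, F →L[ℝ] G) A p A')
    (hψ : HasMFDerivAt (𝓡 2) 𝓘(ℝ, F) ψ p ψ') :
    HasMFDerivAt (𝓡 2) 𝓘(ℝ, G) (fun q => A q (ψ q)) p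
      ((A p).comp ψ' + A'.flip (ψ p) : EuclideanSpace ℝ (Fin 2) →L[ℝ] G) := by
  refine ⟨hA.1.clm_apply hψ.1, ?_⟩
  have h := HasFDerivWithinAt.clm_apply hA.2 hψ.2
  simp only [writtenInExtChartAt, extChartAt_model_space_eq_id, PartialEquiv.refl_coe,
    Function.comp_def, id_eq, extChartAt_to_inv] at h ⊢
  exact h

theorem dSection_toLin (S : M → EndH) (ψ : M → H2) (p : M)
    (hS : MDifferentiableAt (𝓡 2) 𝓘(ℝ, H2 →L[ℝ] H2) (fun q => (S q : H2 →L[ℝ] H2)) p)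
    (hψ : MDifferentiableAt (𝓡 2) 𝓘(ℝ, H2) ψ p) (X : TangentSpace (𝓡 2) p) :
    dSection (fun q => toLin (S q) (ψ q)) p X =
      dEnd S p X (ψ p) + toLin (S p) (dSection ψ p X) := by
  have h5 := congrArg (fun T : TangentSpace (𝓡 2) p →L[ℝ] H2 => T X)
    (hasMFDerivAt_apply hS.hasMFDerivAt hψ.hasMFDerivAt).mfderiv
  refine Eq.trans h5 ?_
  exact add_comm _ _

namespace LineSubbundle

/-- A local frame of `L` around `p`. -/
def frame (L : LineSubbundle M) (p : M) : M → H2 :=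
  (L.exists_frame p).choose_spec.choose

theorem frame_spec (L : LineSubbundle M) (p : M) :
    ContMDiffAt (𝓡 2) 𝓘(ℝ, H2) ∞ (L.frame p) p ∧
      ∀ᶠ q in 𝓝 p, L.frame p q ≠ 0 ∧ L.fiber q = Submodule.span ℍ[ℝ]ᵐᵒᵖ {L.frame p q} := by
  obtain ⟨hU, hp, hs, hq⟩ := (L.exists_frame p).choose_spec.choose_spec
  exact ⟨hs.contMDiffAt (hU.mem_nhds hp), Filter.mem_of_superset (hU.mem_nhds hp) hq⟩

theorem frame_ne_zero (L : LineSubbundle M) (p : M) : L.frame p p ≠ 0 :=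
  (L.frame_spec p).2.self_of_nhds.1

theorem fiber_eq (L : LineSubbundle M) (p : M) :
    L.fiber p = Submodule.span ℍ[ℝ]ᵐᵒᵖ {L.frame p p} :=
  (L.frame_spec p).2.self_of_nhds.2

/-- The coordinate of a vector of `L_p` with respect to the frame. -/
def coord (L : LineSubbundle M) (p : M) : L.fiber p ≃ₗ[ℍ[ℝ]ᵐᵒᵖ] ℍ[ℝ]ᵐᵒᵖ :=
  (LinearEquiv.ofEq _ _ (L.fiber_eq p)).trans
    (LinearEquiv.toSpanNonzeroSingleton ℍ[ℝ]ᵐᵒᵖ H2 (L.frame p p) (L.frame_ne_zero p)).symm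

/-- The derivative `δ ∈ Ω¹(Hom(L, H/L))` of `L`. It is written here with the help of a local frame
`φ`, as `δ(X)(φ a) = dφ(X) a mod L`; by `delta_apply` below,
`δ(X)(ψ(p)) = dψ(X) mod L_p` for every section `ψ` of `L` near `p`. -/
def delta (L : LineSubbundle M) (p : M) :
    TangentSpace (𝓡 2) p →ₗ[ℝ] (L.fiber p →ₗ[ℍ[ℝ]ᵐᵒᵖ] (H2 ⧸ L.fiber p)) where
  toFun X := (L.fiber p).mkQ ∘ₗ
    LinearMap.toSpanSingleton ℍ[ℝ]ᵐᵒᵖ H2 (dSection (L.frame p) p X) ∘ₗ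
      (L.coord p).toLinearMap
  map_add' X Y := by
    ext v
    simp only [LinearMap.comp_apply, LinearMap.toSpanSingleton_apply, map_add,
      LinearMap.add_apply, smul_add]
  map_smul' r X := by
    ext v
    simp only [LinearMap.comp_apply, LinearMap.toSpanSingleton_apply, map_smul,
      LinearMap.smul_apply, RingHom.id_apply]
    rw [smul_comm]
    rfl

/-- The derivative of `L` can be computed with any section of `L` around `p`. -/
theorem delta_apply (L : LineSubbundle M) (p : M) (ψ : M → H2)
    (hψ : MDifferentiableAt (𝓡 2) 𝓘(ℝ, H2) ψ p) (hL : ∀ᶠ q in 𝓝 p, ψ q ∈ L.fiber q)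
    (X : TangentSpace (𝓡 2) p) :
    L.delta p X ⟨ψ p, hL.self_of_nhds⟩ = (L.fiber p).mkQ (dSection ψ p X) := by
  obtain ⟨hs, hev⟩ := L.frame_spec p
  have hφ : MDifferentiableAt (𝓡 2) 𝓘(ℝ, H2) (L.frame p) p := hs.mdifferentiableAt (by simp)
  obtain ⟨i, hi⟩ : ∃ i, L.frame p p i ≠ 0 := by
    by_contra! h
    exact L.frame_ne_zero p (funext h)
  have hcomp : ∀ (χ : M → H2) (_ : MDifferentiableAt (𝓡 2) 𝓘(ℝ, H2) χ p) (j : Fin 2),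
      HasMFDerivAt (𝓡 2) 𝓘(ℝ, ℍ[ℝ]) (fun q => χ q j) p
        ((ContinuousLinearMap.proj (R := ℝ) (φ := fun _ : Fin 2 => ℍ[ℝ]) j).comp
          (dSection χ p)) := by
    intro χ hχ j
    exact (ContinuousLinearMap.proj (R := ℝ) (φ := fun _ : Fin 2 => ℍ[ℝ]) j).hasMFDerivAt.comp p
      hχ.hasMFDerivAt
  have hne : ∀ᶠ q in 𝓝 p, L.frame p q i ≠ 0 :=
    (hcomp _ hφ i).continuousAt.eventually_ne hi
  -- the coordinate function of the section
  let c : M → ℍ[ℝ] := fun q => (L.frame p q i)⁻¹ * ψ q i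
  have hψc : ∀ᶠ q in 𝓝 p, ψ q = MulOpposite.op (c q) • L.frame p q := by
    filter_upwards [hev, hne, hL] with q hq hqi hqL
    rw [hq.2, Submodule.mem_span_singleton] at hqL
    obtain ⟨a, ha⟩ := hqL
    have : c q = a.unop := by
      simp only [c, ← ha, Pi.smul_apply, MulOpposite.smul_eq_mul_unop]
      rw [← mul_assoc, inv_mul_cancel₀ hqi, one_mul]
    rw [this, MulOpposite.op_unop, ha]
  have hc : MDifferentiableAt (𝓡 2) 𝓘(ℝ, ℍ[ℝ]) c p := by
    have h1 : MDifferentiableAt 𝓘(ℝ, ℍ[ℝ]) 𝓘(ℝ, ℍ[ℝ]) (fun x : ℍ[ℝ] => x⁻¹) (L.frame p p i) :=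
      (differentiableAt_inv hi).mdifferentiableAt
    have h2 : MDifferentiableAt (𝓡 2) 𝓘(ℝ, ℍ[ℝ]) (fun q => (L.frame p q i)⁻¹) p :=
      h1.comp p (hcomp _ hφ i).mdifferentiableAt
    exact (h2.hasMFDerivAt.mul' (hcomp _ hψ i)).mdifferentiableAt
  have hcoord : L.coord p ⟨ψ p, hL.self_of_nhds⟩ = MulOpposite.op (c p) := by
    rw [← LinearEquiv.eq_symm_apply]
    apply Subtype.ext
    simpa [coord] using hψc.self_of_nhds
  let c' : TangentSpace (𝓡 2) p →L[ℝ] ℍ[ℝ] := mfderiv (𝓡 2) 𝓘(ℝ, ℍ[ℝ]) c p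
  have key : dSection ψ p X = MulOpposite.op (c p) • dSection (L.frame p) p X +
      MulOpposite.op (c' X) • L.frame p p := by
    funext j
    have h1 := (hcomp _ hφ j).mul' hc.hasMFDerivAt
    have h2 := (h1.congr_of_eventuallyEq
      (hψc.mono fun q hq => by simp [hq] : (fun q => ψ q j) =ᶠ[𝓝 p] _))
    have h3 := hasMFDerivAt_unique (hcomp _ hψ j) h2
    have h4 := congrArg (fun T : TangentSpace (𝓡 2) p →L[ℝ] ℍ[ℝ] => T X) h3
    refine h4.trans ?_
    exact add_comm _ _
  rw [key, map_add]
  have hz : (L.fiber p).mkQ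
      (MulOpposite.op (c' X) • L.frame p p) = 0 := by
    rw [Submodule.mkQ_apply, Submodule.Quotient.mk_eq_zero, L.fiber_eq p]
    exact Submodule.smul_mem _ _ (Submodule.mem_span_singleton_self _)
  rw [hz, add_zero]
  change (L.fiber p).mkQ (L.coord p ⟨ψ p, hL.self_of_nhds⟩ • dSection (L.frame p) p X) = _
  rw [hcoord]

/-- A complex structure on the bundle `L`: a smooth section `J` of `End(L)` with `J² = -1`.
Smoothness means that `J` maps smooth local sections of `L` to smooth local sections. -/
structure ComplexStructure (L : LineSubbundle M) where
  J : ∀ p : M, L.fiber p →ₗ[ℍ[ℝ]ᵐᵒᵖ] L.fiber p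
  J_sq : ∀ (p : M) (v : L.fiber p), J p (J p v) = -v
  smooth_J : ∀ (U : Set M) (ψ : ∀ q : M, L.fiber q), IsOpen U →
    ContMDiffOn (𝓡 2) 𝓘(ℝ, H2) ∞ (fun q => (ψ q : H2)) U →
    ContMDiffOn (𝓡 2) 𝓘(ℝ, H2) ∞ (fun q => (J q (ψ q) : H2)) U

/-- `L` is immersed: its derivative `δ` is injective at every point. -/
def IsImmersed (L : LineSubbundle M) : Prop :=
  ∀ p : M, Function.Injective (L.delta p)

end LineSubbundle

variable [IsManifold (𝓡 2) ∞ M]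

/-- `L` is a holomorphic curve in `ℍP¹`: there is a complex structure `J` on the bundle `L` with
`*δ = δ J`, where `(*δ)(X) = δ(J X)`. -/
def IsHolomorphicCurve (R : RiemannSurfaceStructure M) (L : LineSubbundle M) : Prop :=
  ∃ JL : L.ComplexStructure, ∀ (p : M) (X : TangentSpace (𝓡 2) p),
    L.delta p (R.J p X) = L.delta p X ∘ₗ JL.J p

/-- `S` is a complex structure on the product bundle `M × ℍ²`. -/
structure IsComplexStructure (S : M → EndH) : Prop where
  smooth : ContMDiff (𝓡 2) 𝓘(ℝ, H2 →L[ℝ] H2) ∞ (fun p => (S p : H2 →L[ℝ] H2))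
  sq : ∀ p, S p * S p = -1

/-- The component `d'' = ½ (d + S *d)` of the differential. -/
def dBarPart (R : RiemannSurfaceStructure M) (S : M → EndH) (ψ : M → H2) (p : M)
    (X : TangentSpace (𝓡 2) p) : H2 :=
  (1 / 2 : ℝ) • (dSection ψ p X + toLin (S p) (dSection ψ p (R.J p X)))

/-- The Hopf field `Q = ¼ (S dS - *dS)` of a complex structure `S`, a 1-form with values in
`End(ℍ²)`, where `(*dS)(X) = dS(J X)`. By `hopfQ_apply` below, it is the part of `d''` that
anticommutes with `S`. -/
def hopfQ (R : RiemannSurfaceStructure M) (S : M → EndH) (p : M)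
    (X : TangentSpace (𝓡 2) p) : H2 →L[ℝ] H2 :=
  (1 / 4 : ℝ) • ((S p : H2 →L[ℝ] H2) ∘L dEnd S p X - dEnd S p (R.J p X))

/-- `Q ψ = ½ (d''ψ + S d''(S ψ))`. -/
theorem hopfQ_apply (R : RiemannSurfaceStructure M) (S : M → EndH) (hS : IsComplexStructure S)
    (ψ : M → H2) (p : M) (hψ : MDifferentiableAt (𝓡 2) 𝓘(ℝ, H2) ψ p)
    (X : TangentSpace (𝓡 2) p) :
    hopfQ R S p X (ψ p) = (1 / 2 : ℝ) • (dBarPart R S ψ p X +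
      toLin (S p) (dBarPart R S (fun q => toLin (S q) (ψ q)) p X)) := by
  have hSp := hS.smooth.contMDiffAt (x := p) |>.mdifferentiableAt (by simp)
  have hsq : ∀ v : H2, toLin (S p) (toLin (S p) v) = -v := fun v =>
    congrArg (fun A : EndH => toLin A v) (hS.sq p)
  have hQ : hopfQ R S p X (ψ p) = (1 / 4 : ℝ) •
      (toLin (S p) (dEnd S p X (ψ p)) - dEnd S p (R.J p X) (ψ p)) := rfl
  have hr : ∀ (r : ℝ) (v : H2), toLin (S p) (r • v) = r • toLin (S p) v := fun r v =>
    map_smul (S p : H2 →L[ℝ] H2) r v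
  rw [hQ]
  simp only [dBarPart, dSection_toLin S ψ p hSp hψ, hr, map_add, hsq, map_neg]
  module

/-- The conditions that characterize the mean curvature sphere `S` of `L`. In `conf_left` the
endomorphism `S` is restricted to `L`, and in `conf_right` it is passed to the quotient `H/L`. -/
structure IsMeanCurvatureSphere (R : RiemannSurfaceStructure M) (L : LineSubbundle M)
    (S : M → EndH) : Prop where
  isComplexStructure : IsComplexStructure S
  map_eq : ∀ p, (L.fiber p).map (toLin (S p)) = L.fiber p
  dEnd_mem : ∀ (p : M) (X : TangentSpace (𝓡 2) p), ∀ v ∈ L.fiber p,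
    dEnd S p X v ∈ L.fiber p
  conf_left : ∀ (p : M) (X : TangentSpace (𝓡 2) p),
    L.delta p (R.J p X) =
      L.delta p X ∘ₗ (toLin (S p)).restrict (Submodule.map_le_iff_le_comap.1 (map_eq p).le)
  conf_right : ∀ (p : M) (X : TangentSpace (𝓡 2) p),
    L.delta p (R.J p X) =
      (L.fiber p).mapQ (L.fiber p) (toLin (S p)) (Submodule.map_le_iff_le_comap.1 (map_eq p).le) ∘ₗ
        L.delta p X
  hopfQ_eq_zero : ∀ (p : M) (X : TangentSpace (𝓡 2) p), ∀ v ∈ L.fiber p,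
    hopfQ R S p X v = 0

end QuaternionicCurve

end

/-! Near any point choose a frame `φ` of `L` and a vector field `X` without zeros. Since `L` is
immersed, `ψ = dφ(X)` is nonzero modulo `L`, so `φ`, `ψ` is a quaternionic basis of `ℍ²`.

Call `S` adapted if `S² = -1`, `S L ⊂ L` and `*δ = δ S = S δ`. On `L` it must be the given `J_L`,
because `δ(X)` is injective, and then `S δ = δ S` fixes it on `H/L`. Writing `J_L φ = φ n`, the
choice `S φ = φ n`, `S ψ = ψ n` is adapted (`IsFrameOn.exists_isAdaptedOn`). The condition `dS L ⊂
L` is automatic for adapted `S`.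

If `S` and `T = S + D` are both adapted, `D` kills `L` and has values in `L`. Hence `D² = 0`, and
`T² = -1` amounts to `S D = -D S`. Differentiating `T φ = S φ` gives `dT φ = dS φ - D dφ`, and with
`dφ(J X) ≡ S ψ mod L` the Hopf fields are related by `Q_T(X) φ = Q_S(X) φ - ½ S D ψ`. So exactly one
correction, `D ψ = -2 S Q_S(X) φ`, makes `Q_T(X)` vanish on `L`; it is admissible because `Q_S`
preserves `L` and anticommutes with `S`. The other directions follow from `*Q = -S Q`.

Existence is thus local (`IsFrameOn.exists_hopfQ_eq_zero`), and so is uniqueness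
(`IsAdaptedOn.eq_of_hopfQ_eq_zero`); local solutions agree on overlaps and glue. -/

noncomputable section

namespace QuaternionicCurve

/-! ### Differential calculus of sections and endomorphism fields. -/

section Calculus

variable {M : Type*} [TopologicalSpace M] [ChartedSpace (EuclideanSpace ℝ (Fin 2)) M]

theorem dSection_const (v : H2) (p : M) (X : TangentSpace (𝓡 2) p) :
    dSection (fun _ : M => v) p X = 0 := by
  have h : dSection (fun _ : M => v) p = 0 := mfderiv_const
  rw [h]
  rfl

theorem dSection_congr {ψ χ : M → H2} {p : M} (h : ψ =ᶠ[𝓝 p] χ) (X : TangentSpace (𝓡 2) p) :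
    dSection ψ p X = dSection χ p X := by
  have h' : dSection ψ p = dSection χ p := h.mfderiv_eq
  rw [h']

theorem dEnd_congr {S T : M → EndH} {p : M} (h : S =ᶠ[𝓝 p] T) (X : TangentSpace (𝓡 2) p) :
    dEnd S p X = dEnd T p X := by
  have h' : dEnd S p = dEnd T p := by
    refine Filter.EventuallyEq.mfderiv_eq ?_
    filter_upwards [h] with q hq
    rw [hq]
  rw [h']

/-- The directional derivative of a function along a vector field is smooth. -/
theorem contMDiffOn_mfderiv_apply [IsManifold (𝓡 2) ∞ M] {F : Type*} [NormedAddCommGroup F]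
    [NormedSpace ℝ F] {U : Set M} (hU : IsOpen U) {f : M → F}
    (hf : ContMDiffOn (𝓡 2) 𝓘(ℝ, F) ∞ f U) {X : ∀ q : M, TangentSpace (𝓡 2) q}
    (hX : ContMDiffOn (𝓡 2) (𝓡 2).tangent ∞
      (fun q => (⟨q, X q⟩ : TangentBundle (𝓡 2) M)) U) :
    ContMDiffOn (𝓡 2) 𝓘(ℝ, F) ∞ (fun q => (mfderiv (𝓡 2) 𝓘(ℝ, F) f q (X q) : F)) U := by
  -- Compose the field with the tangent map of `f` and keep the fibre component, which is global for
  -- a vector space target.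
  have h1 := hf.contMDiffOn_tangentMapWithin (m := ∞) le_rfl hU.uniqueMDiffOn
  have h2 := (contMDiff_snd_tangentBundle_modelSpace F 𝓘(ℝ, F) (n := ∞)).comp_contMDiffOn
    (h1.comp hX (fun q hq => hq))
  refine h2.congr fun q hq => ?_
  have h3 : mfderivWithin (𝓡 2) 𝓘(ℝ, F) f U q = mfderiv (𝓡 2) 𝓘(ℝ, F) f q :=
    mfderivWithin_of_isOpen hU hq
  rw [← h3]
  rfl

/-- Around every point there is a smooth vector field without zeros. -/
theorem exists_vectorField_ne_zero [IsManifold (𝓡 2) ∞ M] (p : M) :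
    ∃ (U : Set M) (X : ∀ q : M, TangentSpace (𝓡 2) q), IsOpen U ∧ p ∈ U ∧
      ContMDiffOn (𝓡 2) (𝓡 2).tangent ∞ (fun q => (⟨q, X q⟩ : TangentBundle (𝓡 2) M)) U ∧
      ∀ q ∈ U, X q ≠ 0 := by
  let e := trivializationAt (EuclideanSpace ℝ (Fin 2)) (TangentSpace (𝓡 2) : M → Type _) p
  let b := (EuclideanSpace.basisFun (Fin 2) ℝ).toBasis
  refine ⟨e.baseSet, e.localFrame b 0, e.open_baseSet, FiberBundle.mem_baseSet_trivializationAt' p,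
    e.contMDiffOn_localFrame_baseSet ∞ b 0, fun q hq => ?_⟩
  rw [e.localFrame_apply_of_mem_baseSet b hq]
  exact (e.basisAt b hq).ne_zero 0

theorem dSection_smul (a : ℍ[ℝ]ᵐᵒᵖ) {ψ : M → H2} {p : M}
    (hψ : MDifferentiableAt (𝓡 2) 𝓘(ℝ, H2) ψ p) (X : TangentSpace (𝓡 2) p) :
    dSection (fun q => a • ψ q) p X = a • dSection ψ p X := by
  let T : H2 →L[ℝ] H2 := LinearMap.toContinuousLinearMap
    { toFun := fun v => a • v
      map_add' := smul_add a
      map_smul' := fun r v => (smul_comm r a v).symm }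
  have h := T.hasMFDerivAt.comp p hψ.hasMFDerivAt
  exact congrArg (fun A : TangentSpace (𝓡 2) p →L[ℝ] H2 => A X) h.mfderiv

/-- `dS(X) w` is the derivative of `q ↦ S_q w` with `w` constant, and right multiplication by `a`
commutes with differentiation. So `dS` has values in quaternionic linear maps. -/
theorem dEnd_smul {S : M → EndH} {p : M}
    (hS : MDifferentiableAt (𝓡 2) 𝓘(ℝ, H2 →L[ℝ] H2) (fun q => (S q : H2 →L[ℝ] H2)) p)
    (X : TangentSpace (𝓡 2) p) (a : ℍ[ℝ]ᵐᵒᵖ) (v : H2) :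
    dEnd S p X (a • v) = a • dEnd S p X v := by
  have h : ∀ w : H2, dEnd S p X w = dSection (fun q => toLin (S q) w) p X := fun w => by
    rw [dSection_toLin S (fun _ => w) p hS mdifferentiableAt_const X, dSection_const, map_zero,
      add_zero]
  have h' : MDifferentiableAt (𝓡 2) 𝓘(ℝ, H2) (fun q => toLin (S q) v) p :=
    (hasMFDerivAt_apply hS.hasMFDerivAt
      (mdifferentiableAt_const (c := v)).hasMFDerivAt).mdifferentiableAt
  rw [h, h, ← dSection_smul a h']
  simp only [map_smul]

/-- The derivative of a complex structure anticommutes with it. -/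
theorem dEnd_anticomm {S : M → EndH} {p : M}
    (hS : MDifferentiableAt (𝓡 2) 𝓘(ℝ, H2 →L[ℝ] H2) (fun q => (S q : H2 →L[ℝ] H2)) p)
    (hsq : ∀ᶠ q in 𝓝 p, S q * S q = -1) (X : TangentSpace (𝓡 2) p) (v : H2) :
    dEnd S p X (toLin (S p) v) = -toLin (S p) (dEnd S p X v) := by
  have h' : MDifferentiableAt (𝓡 2) 𝓘(ℝ, H2) (fun q => toLin (S q) v) p :=
    (hasMFDerivAt_apply hS.hasMFDerivAt
      (mdifferentiableAt_const (c := v)).hasMFDerivAt).mdifferentiableAt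
  have h1 := dSection_toLin S (fun q => toLin (S q) v) p hS h' X
  -- `S (S v) = -v` is constant near `p`; the product rule then gives the claim.
  have h2 : dSection (fun q => toLin (S q) (toLin (S q) v)) p X = 0 := by
    rw [← dSection_const (-v) p X]
    refine dSection_congr ?_ X
    filter_upwards [hsq] with q hq
    exact congrArg (fun A : EndH => toLin A v) hq
  rw [h2, dSection_toLin S (fun _ => v) p hS mdifferentiableAt_const X, dSection_const, map_zero,
    add_zero] at h1
  exact eq_neg_of_add_eq_zero_left h1.symm

theorem toLin_toLin_of_sq {A : EndH} (h : A * A = -1) (v : H2) : toLin A (toLin A v) = -v :=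
  congrArg (fun A : EndH => toLin A v) h

theorem toLin_real_smul (A : EndH) (r : ℝ) (v : H2) : toLin A (r • v) = r • toLin A v :=
  map_smul (A : H2 →L[ℝ] H2) r v

/-! ### Linear algebra of bases of `ℍ²`. -/

/-- `v` and `J v` span a real plane. -/
theorem exists_eq_smul_add_smul {V : Type*} [AddCommGroup V] [Module ℝ V]
    (hV : Module.finrank ℝ V = 2) {J : V →ₗ[ℝ] V} (hJ : ∀ v, J (J v) = -v) {v : V} (hv : v ≠ 0)
    (w : V) : ∃ a b : ℝ, w = a • v + b • J v := by
  have hli : LinearIndependent ℝ ![v, J v] := by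
    rw [LinearIndependent.pair_iff]
    intro s t h
    have h2 : s • J v - t • v = 0 := by
      have := congrArg J h
      simpa [hJ, sub_eq_add_neg] using this
    have h3 : (s * s + t * t) • v = 0 := by
      have : (s * s + t * t) • v = s • (s • v + t • J v) - t • (s • J v - t • v) := by module
      rw [this, h, h2]; simp
    have h4 := (smul_eq_zero.1 h3).resolve_right hv
    constructor <;> nlinarith [mul_self_nonneg s, mul_self_nonneg t]
  have : FiniteDimensional ℝ V := Module.finite_of_finrank_pos (by omega)
  have hspan := hli.span_eq_top_of_card_eq_finrank' (by simp [hV])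
  have hw : w ∈ Submodule.span ℝ (Set.range ![v, J v]) := hspan ▸ Submodule.mem_top
  rw [Matrix.range_cons, Matrix.range_cons, Matrix.range_empty, Set.union_empty,
    Set.singleton_union, Submodule.mem_span_pair] at hw
  obtain ⟨a, b, h⟩ := hw
  exact ⟨a, b, h.symm⟩

/-- The real linear map that takes `φ`, `ψ` to the endomorphism of `ℍ²` with columns `φ`, `ψ`. -/
def ofColumns : H2 × H2 →L[ℝ] (H2 →L[ℝ] H2) :=
  LinearMap.toContinuousLinearMap
    { toFun := fun x => LinearMap.toContinuousLinearMap
        { toFun := fun v => MulOpposite.op (v 0) • x.1 + MulOpposite.op (v 1) • x.2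
          map_add' := fun v w => by
            simp only [Pi.add_apply, MulOpposite.op_add, add_smul]
            abel
          map_smul' := fun r v => by
            simp only [Pi.smul_apply, MulOpposite.op_smul, smul_assoc, RingHom.id_apply, smul_add] }
      map_add' := fun x y => by
        ext1 v
        simp only [LinearMap.coe_toContinuousLinearMap', LinearMap.coe_mk, AddHom.coe_mk,
          Prod.fst_add, Prod.snd_add, smul_add, add_apply]
        abel
      map_smul' := fun r x => by
        ext1 v
        simp only [LinearMap.coe_toContinuousLinearMap', LinearMap.coe_mk, AddHom.coe_mk,
          Prod.smul_fst, Prod.smul_snd, smul_add, RingHom.id_apply,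
          smul_apply, smul_comm r] }

theorem ofColumns_apply (x : H2 × H2) (v : H2) :
    ofColumns x v = MulOpposite.op (v 0) • x.1 + MulOpposite.op (v 1) • x.2 := rfl

theorem ofColumns_mem (x : H2 × H2) : ofColumns x ∈ EndH := fun a v => by
  simp only [ofColumns_apply, Pi.smul_apply, MulOpposite.smul_eq_mul_unop, MulOpposite.op_mul,
    MulOpposite.op_unop, mul_smul, smul_add]

theorem isUnit_ofColumns {φ ψ : H2}
    (h : ∀ a b : ℍ[ℝ]ᵐᵒᵖ, a • φ + b • ψ = 0 → a = 0 ∧ b = 0) : IsUnit (ofColumns (φ, ψ)) := by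
  have hinj : Function.Injective (ofColumns (φ, ψ)) := by
    rw [injective_iff_map_eq_zero]
    intro v hv
    obtain ⟨h0, h1⟩ := h _ _ hv
    funext i
    fin_cases i
    · exact MulOpposite.op_injective h0
    · exact MulOpposite.op_injective h1
  rw [ContinuousLinearMap.isUnit_iff_bijective]
  exact ⟨hinj, LinearMap.surjective_of_injective (f := (ofColumns (φ, ψ)).toLinearMap) hinj⟩

theorem eq_of_isUnit_ofColumns {φ ψ : H2} (h : IsUnit (ofColumns (φ, ψ)))
    {A B : H2 →ₗ[ℍ[ℝ]ᵐᵒᵖ] H2} (h0 : A φ = B φ) (h1 : A ψ = B ψ) : A = B := by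
  rw [ContinuousLinearMap.isUnit_iff_bijective] at h
  refine LinearMap.ext fun v => ?_
  obtain ⟨w, rfl⟩ := h.2 v
  simp only [ofColumns_apply, map_add, map_smul, h0, h1]

/-- The endomorphism of `ℍ²` that takes the basis `x` to the vectors `y`. -/
def ofBasis (x y : H2 × H2) : H2 →L[ℝ] H2 := ofColumns y * Ring.inverse (ofColumns x)

/-- The inverse of a quaternionic linear bijection is quaternionic linear, and `Ring.inverse` is `0`
otherwise. Hence `ofBasis` lands in `EndH` even where `x` is not a basis, and local fields can be
defined on all of `M`. -/
theorem inverse_ofColumns_mem (x : H2 × H2) : Ring.inverse (ofColumns x) ∈ EndH := by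
  by_cases h : IsUnit (ofColumns x)
  · intro a v
    have hinj := (ContinuousLinearMap.isUnit_iff_bijective.1 h).1
    have hc : ∀ w, ofColumns x (Ring.inverse (ofColumns x) w) = w := fun w =>
      congrArg (fun A : H2 →L[ℝ] H2 => A w) (Ring.mul_inverse_cancel _ h)
    apply hinj
    rw [hc, ofColumns_mem x, hc]
  · rw [Ring.inverse_non_unit _ h]
    exact EndH.zero_mem

theorem ofBasis_mem (x y : H2 × H2) : ofBasis x y ∈ EndH :=
  EndH.mul_mem (ofColumns_mem y) (inverse_ofColumns_mem x)

theorem inverse_ofColumns_apply_smul {x : H2 × H2} (h : IsUnit (ofColumns x)) (a b : ℍ[ℝ]) :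
    Ring.inverse (ofColumns x) (MulOpposite.op a • x.1 + MulOpposite.op b • x.2) = ![a, b] := by
  have h1 := congrArg (fun A : H2 →L[ℝ] H2 => A ![a, b]) (Ring.inverse_mul_cancel _ h)
  exact h1

theorem ofBasis_apply_fst {x : H2 × H2} (h : IsUnit (ofColumns x)) (y : H2 × H2) :
    ofBasis x y x.1 = y.1 := by
  have h1 := inverse_ofColumns_apply_smul h 1 0
  have h2 : ofBasis x y x.1 = ofColumns y (Ring.inverse (ofColumns x) x.1) := rfl
  rw [MulOpposite.op_one, one_smul, MulOpposite.op_zero, zero_smul, add_zero] at h1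
  rw [h2, h1, ofColumns_apply]
  simp

theorem ofBasis_apply_snd {x : H2 × H2} (h : IsUnit (ofColumns x)) (y : H2 × H2) :
    ofBasis x y x.2 = y.2 := by
  have h1 := inverse_ofColumns_apply_smul h 0 1
  have h2 : ofBasis x y x.2 = ofColumns y (Ring.inverse (ofColumns x) x.2) := rfl
  rw [MulOpposite.op_one, one_smul, MulOpposite.op_zero, zero_smul, zero_add] at h1
  rw [h2, h1, ofColumns_apply]
  simp

theorem contMDiff_ofColumns :
    ContMDiff 𝓘(ℝ, H2 × H2) 𝓘(ℝ, H2 →L[ℝ] H2) ∞ (fun x => ofColumns x) :=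
  ContinuousLinearMap.contMDiff (𝕜 := ℝ) (E := H2 × H2) (F := H2 →L[ℝ] H2) ofColumns

theorem contMDiffOn_inverse_ofColumns {U : Set M} {x : M → H2 × H2}
    (hx : ContMDiffOn (𝓡 2) 𝓘(ℝ, H2 × H2) ∞ x U) (h : ∀ p ∈ U, IsUnit (ofColumns (x p))) :
    ContMDiffOn (𝓡 2) 𝓘(ℝ, H2 →L[ℝ] H2) ∞ (fun p => Ring.inverse (ofColumns (x p))) U := by
  intro p hp
  obtain ⟨u, hu⟩ := h p hp
  have h1 : ContDiffAt ℝ ∞ Ring.inverse (ofColumns (x p)) := by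
    rw [← hu]
    exact contDiffAt_ringInverse ℝ (R := H2 →L[ℝ] H2) u
  exact h1.contMDiffAt.comp_contMDiffWithinAt p (contMDiff_ofColumns.comp_contMDiffOn hx p hp)

theorem contMDiffOn_ofBasis {U : Set M} {x y : M → H2 × H2}
    (hx : ContMDiffOn (𝓡 2) 𝓘(ℝ, H2 × H2) ∞ x U) (hy : ContMDiffOn (𝓡 2) 𝓘(ℝ, H2 × H2) ∞ y U)
    (h : ∀ p ∈ U, IsUnit (ofColumns (x p))) :
    ContMDiffOn (𝓡 2) 𝓘(ℝ, H2 →L[ℝ] H2) ∞ (fun p => ofBasis (x p) (y p)) U :=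
  (contMDiff_ofColumns.comp_contMDiffOn hy).clm_comp (contMDiffOn_inverse_ofColumns hx h)

end Calculus

/-! ### Adapted complex structures and uniqueness. -/

section Uniqueness

variable {M : Type*} [TopologicalSpace M] [ChartedSpace (EuclideanSpace ℝ (Fin 2)) M]

theorem LineSubbundle.frame_mdifferentiableAt (L : LineSubbundle M) (p : M) :
    MDifferentiableAt (𝓡 2) 𝓘(ℝ, H2) (L.frame p) p :=
  (L.frame_spec p).1.mdifferentiableAt (by simp)

theorem LineSubbundle.frame_eventually_mem (L : LineSubbundle M) (p : M) :
    ∀ᶠ q in 𝓝 p, L.frame p q ∈ L.fiber q :=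
  (L.frame_spec p).2.mono fun _ hq => hq.2 ▸ Submodule.mem_span_singleton_self _

/-- On a curve that is immersed, `δ(X)` is injective for `X ≠ 0`. -/
theorem LineSubbundle.delta_injective {L : LineSubbundle M} (hL : L.IsImmersed) {p : M}
    {X : TangentSpace (𝓡 2) p} (hX : X ≠ 0) : Function.Injective (L.delta p X) := by
  rw [injective_iff_map_eq_zero]
  intro v hv
  by_contra hne
  refine hX (hL p ?_)
  rw [map_zero]
  ext w
  have hc : L.coord p v ≠ 0 := by simpa using hne
  -- The fibre is a quaternionic line, so `δ(X) v = 0` for one `v ≠ 0` gives `δ(X) = 0`.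
  have hw : w = (L.coord p w * (L.coord p v)⁻¹) • v := by
    apply (L.coord p).injective
    rw [map_smul, smul_eq_mul, mul_assoc, inv_mul_cancel₀ hc, mul_one]
  rw [hw, map_smul, hv, smul_zero]
  rfl

/-- A nonzero vector of `L` and its derivative in a nonzero direction form a basis of `ℍ²`. -/
theorem LineSubbundle.smul_add_smul_eq_zero {L : LineSubbundle M} (hL : L.IsImmersed) {p : M}
    {X : TangentSpace (𝓡 2) p} (hX : X ≠ 0) {ψ : M → H2}
    (hψ : MDifferentiableAt (𝓡 2) 𝓘(ℝ, H2) ψ p) (hψL : ∀ᶠ q in 𝓝 p, ψ q ∈ L.fiber q)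
    (h0 : ψ p ≠ 0) {a b : ℍ[ℝ]ᵐᵒᵖ} (h : a • ψ p + b • dSection ψ p X = 0) : a = 0 ∧ b = 0 := by
  -- Modulo `L` only `δ(X)(ψ b) = 0` remains.
  have h1 := congrArg (L.fiber p).mkQ h
  have ha : (L.fiber p).mkQ (a • ψ p) = 0 := by
    rw [Submodule.mkQ_apply, Submodule.Quotient.mk_eq_zero]
    exact Submodule.smul_mem _ _ hψL.self_of_nhds
  rw [map_add, ha, zero_add, map_zero, map_smul, ← L.delta_apply p ψ hψ hψL X, ← map_smul] at h1
  have h2 := delta_injective hL hX (h1.trans (map_zero _).symm)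
  have h3 : b • ψ p = 0 := congrArg Subtype.val h2
  have hb : b = 0 := (smul_eq_zero.1 h3).resolve_right h0
  refine ⟨?_, hb⟩
  rw [hb, zero_smul, add_zero] at h
  exact (smul_eq_zero.1 h).resolve_right h0

variable [IsManifold (𝓡 2) ∞ M]

theorem hopfQ_apply_eq {R : RiemannSurfaceStructure M} {S : M → EndH} {p : M}
    (X : TangentSpace (𝓡 2) p) (v : H2) :
    hopfQ R S p X v =
      (1 / 4 : ℝ) • (toLin (S p) (dEnd S p X v) - dEnd S p (R.J p X) v) := rfl

theorem hopfQ_apply_eq_zero_iff {R : RiemannSurfaceStructure M} {S : M → EndH} {p : M}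
    {X : TangentSpace (𝓡 2) p} {v : H2} :
    hopfQ R S p X v = 0 ↔ dEnd S p (R.J p X) v = toLin (S p) (dEnd S p X v) := by
  rw [hopfQ_apply_eq, smul_eq_zero, sub_eq_zero, or_iff_right (by norm_num), eq_comm]

/-- Over the open set `U`, the endomorphism field `S` is a complex structure that preserves `L`
and satisfies `*δ = δ ∘ S = S ∘ δ`. -/
structure IsAdaptedOn (R : RiemannSurfaceStructure M) (L : LineSubbundle M) (S : M → EndH)
    (U : Set M) : Prop where
  isOpen : IsOpen U
  smooth : ContMDiffOn (𝓡 2) 𝓘(ℝ, H2 →L[ℝ] H2) ∞ (fun p => (S p : H2 →L[ℝ] H2)) U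
  sq : ∀ p ∈ U, S p * S p = -1
  mem : ∀ p ∈ U, ∀ v ∈ L.fiber p, toLin (S p) v ∈ L.fiber p
  conf_left : ∀ p (hp : p ∈ U) (X : TangentSpace (𝓡 2) p) v (hv : v ∈ L.fiber p),
    L.delta p (R.J p X) ⟨v, hv⟩ = L.delta p X ⟨toLin (S p) v, mem p hp v hv⟩
  conf_right : ∀ p ∈ U, ∀ (X : TangentSpace (𝓡 2) p) (v : L.fiber p) (w : H2),
    L.delta p X v = (L.fiber p).mkQ w → L.delta p (R.J p X) v = (L.fiber p).mkQ (toLin (S p) w)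

namespace IsAdaptedOn

variable {R : RiemannSurfaceStructure M} {L : LineSubbundle M} {S T : M → EndH} {U V : Set M}

theorem mdifferentiableAt (h : IsAdaptedOn R L S U) {p : M} (hp : p ∈ U) :
    MDifferentiableAt (𝓡 2) 𝓘(ℝ, H2 →L[ℝ] H2) (fun q => (S q : H2 →L[ℝ] H2)) p :=
  (h.smooth.contMDiffAt (h.isOpen.mem_nhds hp)).mdifferentiableAt (by simp)

/-- `dψ(J X) ≡ S dψ(X)` modulo `L` for sections `ψ` of `L`. -/
theorem dSection_J_sub_mem (h : IsAdaptedOn R L S U) {p : M} (hp : p ∈ U) {ψ : M → H2}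
    (hψ : MDifferentiableAt (𝓡 2) 𝓘(ℝ, H2) ψ p) (hL : ∀ᶠ q in 𝓝 p, ψ q ∈ L.fiber q)
    (X : TangentSpace (𝓡 2) p) :
    dSection ψ p (R.J p X) - toLin (S p) (dSection ψ p X) ∈ L.fiber p := by
  rw [← Submodule.Quotient.mk_eq_zero, ← Submodule.mkQ_apply, map_sub, sub_eq_zero,
    ← L.delta_apply p ψ hψ hL, h.conf_right p hp X _ _ (L.delta_apply p ψ hψ hL X)]

/-- Both `ψ` and `S ψ` are sections of `L`, so `d(S ψ) = dS ψ + S dψ` reads modulo `L` as `δ(S ψ) =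
dS ψ + S δ(ψ)`. Since `δ S = S δ`, the term `dS ψ` vanishes modulo `L`. -/
theorem dEnd_section_mem (h : IsAdaptedOn R L S U) {p : M} (hp : p ∈ U) {ψ : M → H2}
    (hψ : MDifferentiableAt (𝓡 2) 𝓘(ℝ, H2) ψ p) (hL : ∀ᶠ q in 𝓝 p, ψ q ∈ L.fiber q)
    (X : TangentSpace (𝓡 2) p) : dEnd S p X (ψ p) ∈ L.fiber p := by
  have hS := h.mdifferentiableAt hp
  have hSψ : MDifferentiableAt (𝓡 2) 𝓘(ℝ, H2) (fun q => toLin (S q) (ψ q)) p :=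
    (hasMFDerivAt_apply hS.hasMFDerivAt hψ.hasMFDerivAt).mdifferentiableAt
  have hSL : ∀ᶠ q in 𝓝 p, toLin (S q) (ψ q) ∈ L.fiber q := by
    filter_upwards [hL, h.isOpen.mem_nhds hp] with q hq hqU
    exact h.mem q hqU _ hq
  have h1 := dSection_toLin S ψ p hS hψ X
  have h2 : (L.fiber p).mkQ (dSection (fun q => toLin (S q) (ψ q)) p X) =
      (L.fiber p).mkQ (toLin (S p) (dSection ψ p X)) := by
    rw [← L.delta_apply p _ hSψ hSL, ← h.conf_right p hp X _ _ (L.delta_apply p ψ hψ hL X),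
      h.conf_left p hp]
  rw [h1, map_add, add_eq_right, Submodule.mkQ_apply, Submodule.Quotient.mk_eq_zero] at h2
  exact h2

theorem dEnd_mem (h : IsAdaptedOn R L S U) {p : M} (hp : p ∈ U) (X : TangentSpace (𝓡 2) p)
    {v : H2} (hv : v ∈ L.fiber p) : dEnd S p X v ∈ L.fiber p := by
  rw [L.fiber_eq p, Submodule.mem_span_singleton] at hv
  obtain ⟨a, rfl⟩ := hv
  rw [dEnd_smul (h.mdifferentiableAt hp)]
  exact Submodule.smul_mem _ _ (h.dEnd_section_mem hp (L.frame_mdifferentiableAt p)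
    (L.frame_eventually_mem p) X)

/-- `S` is determined on `L`. -/
theorem eq_on_fiber (hL : L.IsImmersed) (hS : IsAdaptedOn R L S U) (hT : IsAdaptedOn R L T V)
    {p : M} (hpU : p ∈ U) (hpV : p ∈ V) {v : H2} (hv : v ∈ L.fiber p) :
    toLin (S p) v = toLin (T p) v := by
  obtain ⟨W, X, -, hpW, -, hX⟩ := exists_vectorField_ne_zero p
  have h := (hS.conf_left p hpU (X p) v hv).symm.trans (hT.conf_left p hpV (X p) v hv)
  exact congrArg Subtype.val (LineSubbundle.delta_injective hL (hX p hpW) h)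

/-- Adapted complex structures whose Hopf fields vanish on `L` agree. -/
theorem eq_of_hopfQ_eq_zero (hL : L.IsImmersed) (hS : IsAdaptedOn R L S U)
    (hT : IsAdaptedOn R L T V)
    (hQS : ∀ p ∈ U, ∀ (X : TangentSpace (𝓡 2) p), ∀ v ∈ L.fiber p, hopfQ R S p X v = 0)
    (hQT : ∀ p ∈ V, ∀ (X : TangentSpace (𝓡 2) p), ∀ v ∈ L.fiber p, hopfQ R T p X v = 0)
    {p : M} (hpU : p ∈ U) (hpV : p ∈ V) : S p = T p := by
  obtain ⟨W, Y, -, hpW, -, hY⟩ := exists_vectorField_ne_zero p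
  set X := Y p
  have hX : X ≠ 0 := hY p hpW
  set φ := L.frame p
  have hφ : MDifferentiableAt (𝓡 2) 𝓘(ℝ, H2) φ p := L.frame_mdifferentiableAt p
  have hφL : ∀ᶠ q in 𝓝 p, φ q ∈ L.fiber q := L.frame_eventually_mem p
  have hφp : φ p ∈ L.fiber p := hφL.self_of_nhds
  have hSd := hS.mdifferentiableAt hpU
  have hTd := hT.mdifferentiableAt hpV
  have hST : ∀ {v}, v ∈ L.fiber p → toLin (S p) v = toLin (T p) v :=
    fun hv => hS.eq_on_fiber hL hT hpU hpV hv
  -- Differentiate `S φ = T φ`, which holds near `p` and not just at `p`.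
  have hd : ∀ Z : TangentSpace (𝓡 2) p, dEnd T p Z (φ p) - dEnd S p Z (φ p) =
      toLin (S p) (dSection φ p Z) - toLin (T p) (dSection φ p Z) := fun Z => by
    have h1 := dSection_toLin S φ p hSd hφ Z
    have h2 := dSection_toLin T φ p hTd hφ Z
    have h3 : dSection (fun q => toLin (S q) (φ q)) p Z =
        dSection (fun q => toLin (T q) (φ q)) p Z := by
      refine dSection_congr ?_ Z
      filter_upwards [hφL, hS.isOpen.mem_nhds hpU, hT.isOpen.mem_nhds hpV] with q hq hqU hqV
      exact hS.eq_on_fiber hL hT hqU hqV hq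
    rw [h1, h2] at h3
    rw [sub_eq_sub_iff_add_eq_add, ← h3, add_comm]
  set ψ := dSection φ p X
  set D := toLin (S p) - toLin (T p) with hDdef
  have hDL : ∀ {v}, v ∈ L.fiber p → D v = 0 := fun hv => by
    rw [hDdef, LinearMap.sub_apply, hST hv, sub_self]
  have hDψ : D ψ ∈ L.fiber p := by
    have := hd X
    rw [hDdef, LinearMap.sub_apply, ← this]
    exact Submodule.sub_mem _ (hT.dEnd_mem hpV X hφp) (hS.dEnd_mem hpU X hφp)
  have hQ1 := hopfQ_apply_eq_zero_iff.1 (hQS p hpU X _ hφp)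
  have hQ2 := hopfQ_apply_eq_zero_iff.1 (hQT p hpV X _ hφp)
  -- Vanishing Hopf fields turn `dS(J X) φ` into `S dS(X) φ`, and likewise for `T`; the difference
  -- is evaluated on `L`, where `S = T`.
  have h1 : D (dSection φ p (R.J p X)) = toLin (S p) (D ψ) := by
    have hJ := hd (R.J p X)
    have hX' := hd X
    rw [hQ1, hQ2, ← hST (hT.dEnd_mem hpV X hφp), ← map_sub, hX'] at hJ
    exact hJ.symm
  have h2 : D (dSection φ p (R.J p X)) = D (toLin (S p) ψ) := by
    rw [← sub_eq_zero, ← map_sub]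
    exact hDL (hS.dSection_J_sub_mem hpU hφ hφL X)
  -- `S D + D S = 0` on `ψ`, from `S² = T² = -1` and `S D ψ = T D ψ`. Against the two preceding
  -- identities, `S D ψ` equals its own negative.
  have h3 : toLin (S p) (D ψ) + D (toLin (S p) ψ) = 0 := by
    have hsS := toLin_toLin_of_sq (hS.sq p hpU) ψ
    have hsT := toLin_toLin_of_sq (hT.sq p hpV) ψ
    have hT' : toLin (T p) ψ = toLin (S p) ψ - D ψ := by
      rw [hDdef, LinearMap.sub_apply]; abel
    have e1 : toLin (S p) (D ψ) = toLin (T p) (D ψ) := hST hDψ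
    rw [hT', map_sub, ← e1] at hsT
    have e2 : D (toLin (S p) ψ) = toLin (S p) (toLin (S p) ψ) - toLin (T p) (toLin (S p) ψ) := rfl
    rw [e2, hsS, ← hsT]
    abel
  have h4 : toLin (S p) (D ψ) = 0 := by
    rw [← h2, h1] at h3
    rw [← two_smul ℝ] at h3
    exact (smul_eq_zero.1 h3).resolve_left two_ne_zero
  have h5 : D ψ = 0 := by
    rw [← neg_eq_zero, ← toLin_toLin_of_sq (hS.sq p hpU), h4, map_zero]
  have hB : IsUnit (ofColumns (φ p, ψ)) := isUnit_ofColumns fun a b hab =>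
    LineSubbundle.smul_add_smul_eq_zero hL hX hφ hφL (L.frame_ne_zero p) hab
  have h6 : toLin (S p) = toLin (T p) :=
    eq_of_isUnit_ofColumns hB (hST hφp) (sub_eq_zero.1 h5)
  apply Subtype.ext
  ext1 v
  exact congrArg (fun A => A v) h6

end IsAdaptedOn

end Uniqueness

/-! ### Local frames and existence of adapted complex structures. -/

section Frames

variable {M : Type*} [TopologicalSpace M] [ChartedSpace (EuclideanSpace ℝ (Fin 2)) M]
  [IsManifold (𝓡 2) ∞ M] {R : RiemannSurfaceStructure M} {L : LineSubbundle M}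

theorem exists_eq_smul_add_smul_J (R : RiemannSurfaceStructure M) {p : M}
    {X : TangentSpace (𝓡 2) p} (hX : X ≠ 0) (Y : TangentSpace (𝓡 2) p) :
    ∃ a b : ℝ, Y = a • X + b • R.J p X :=
  exists_eq_smul_add_smul (finrank_euclideanSpace_fin (𝕜 := ℝ) (n := 2)) (R.J_sq p) hX Y

/-- Both sides are real linear in the direction, and `X`, `J X` span the tangent plane. The case `J
X` follows from the case `X` by `J² = -1` and `A² = -1`. -/
theorem conf_right_of_ne_zero {p : M} {A : H2 →ₗ[ℍ[ℝ]ᵐᵒᵖ] H2} (hsq : ∀ v, A (A v) = -v)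
    (hA : L.fiber p ≤ (L.fiber p).comap A) {X : TangentSpace (𝓡 2) p} (hX : X ≠ 0)
    (h : L.delta p (R.J p X) = (L.fiber p).mapQ (L.fiber p) A hA ∘ₗ L.delta p X)
    (Y : TangentSpace (𝓡 2) p) :
    L.delta p (R.J p Y) = (L.fiber p).mapQ (L.fiber p) A hA ∘ₗ L.delta p Y := by
  obtain ⟨a, b, rfl⟩ := exists_eq_smul_add_smul_J R hX Y
  have hq : ∀ w, (L.fiber p).mapQ (L.fiber p) A hA ((L.fiber p).mapQ (L.fiber p) A hA w) = -w := by
    intro w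
    obtain ⟨w, rfl⟩ := (L.fiber p).mkQ_surjective w
    simp [hsq]
  have hr : ∀ (r : ℝ) w, (L.fiber p).mapQ (L.fiber p) A hA (r • w) =
      r • (L.fiber p).mapQ (L.fiber p) A hA w := by
    exact LinearMap.map_smul_of_tower _
  ext1 v
  simp only [map_add, map_smul, R.J_sq, map_neg, h, LinearMap.add_apply, LinearMap.comp_apply,
    LinearMap.smul_apply, LinearMap.neg_apply, hr, hq]

/-- A frame `φ` of `L` together with a vector field without zeros, over the open set `U`. -/
structure IsFrameOn (L : LineSubbundle M) (φ : M → H2) (X : ∀ q : M, TangentSpace (𝓡 2) q)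
    (U : Set M) : Prop where
  isOpen : IsOpen U
  smooth : ContMDiffOn (𝓡 2) 𝓘(ℝ, H2) ∞ φ U
  smooth_field : ContMDiffOn (𝓡 2) (𝓡 2).tangent ∞
    (fun q => (⟨q, X q⟩ : TangentBundle (𝓡 2) M)) U
  ne_zero : ∀ q ∈ U, φ q ≠ 0
  field_ne_zero : ∀ q ∈ U, X q ≠ 0
  fiber_eq : ∀ q ∈ U, L.fiber q = Submodule.span ℍ[ℝ]ᵐᵒᵖ {φ q}

theorem exists_isFrameOn (L : LineSubbundle M) (p : M) : ∃ φ X U, p ∈ U ∧ IsFrameOn L φ X U := by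
  obtain ⟨U, φ, hU, hpU, hφ, h⟩ := L.exists_frame p
  obtain ⟨V, X, hV, hpV, hX, hX0⟩ := exists_vectorField_ne_zero p
  exact ⟨φ, X, U ∩ V, ⟨hpU, hpV⟩, hU.inter hV, hφ.mono Set.inter_subset_left,
    hX.mono Set.inter_subset_right, fun q hq => (h q hq.1).1, fun q hq => hX0 q hq.2,
    fun q hq => (h q hq.1).2⟩

namespace IsFrameOn

variable {φ : M → H2} {X : ∀ q : M, TangentSpace (𝓡 2) q} {U : Set M}

theorem mem (h : IsFrameOn L φ X U) {q : M} (hq : q ∈ U) : φ q ∈ L.fiber q :=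
  h.fiber_eq q hq ▸ Submodule.mem_span_singleton_self _

theorem exists_smul_eq (h : IsFrameOn L φ X U) {q : M} (hq : q ∈ U) {v : H2}
    (hv : v ∈ L.fiber q) : ∃ a : ℍ[ℝ]ᵐᵒᵖ, a • φ q = v := by
  rwa [h.fiber_eq q hq, Submodule.mem_span_singleton] at hv

theorem eventually_mem (h : IsFrameOn L φ X U) {q : M} (hq : q ∈ U) :
    ∀ᶠ q' in 𝓝 q, φ q' ∈ L.fiber q' :=
  Filter.mem_of_superset (h.isOpen.mem_nhds hq) fun _ => h.mem

theorem mdifferentiableAt (h : IsFrameOn L φ X U) {q : M} (hq : q ∈ U) :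
    MDifferentiableAt (𝓡 2) 𝓘(ℝ, H2) φ q :=
  (h.smooth.contMDiffAt (h.isOpen.mem_nhds hq)).mdifferentiableAt (by simp)

theorem delta_apply (h : IsFrameOn L φ X U) {q : M} (hq : q ∈ U) (Y : TangentSpace (𝓡 2) q) :
    L.delta q Y ⟨φ q, h.mem hq⟩ = (L.fiber q).mkQ (dSection φ q Y) :=
  L.delta_apply q φ (h.mdifferentiableAt hq) (h.eventually_mem hq) Y

theorem isUnit (h : IsFrameOn L φ X U) (hL : L.IsImmersed) {q : M} (hq : q ∈ U) :
    IsUnit (ofColumns (φ q, dSection φ q (X q))) :=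
  isUnit_ofColumns fun _ _ hab => LineSubbundle.smul_add_smul_eq_zero hL (h.field_ne_zero q hq)
    (h.mdifferentiableAt hq) (h.eventually_mem hq) (h.ne_zero q hq) hab

theorem smooth_columns (h : IsFrameOn L φ X U) :
    ContMDiffOn (𝓡 2) 𝓘(ℝ, H2 × H2) ∞ (fun q => (φ q, dSection φ q (X q))) U :=
  h.smooth.prodMk_space (contMDiffOn_mfderiv_apply h.isOpen h.smooth h.smooth_field)

theorem smooth_J_field (R : RiemannSurfaceStructure M) (h : IsFrameOn L φ X U) :
    ContMDiffOn (𝓡 2) (𝓡 2).tangent ∞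
      (fun q => (⟨q, R.J q (X q)⟩ : TangentBundle (𝓡 2) M)) U :=
  R.smooth_J.comp_contMDiffOn h.smooth_field

/-- Around every point there is a complex structure adapted to `L`. -/
theorem exists_isAdaptedOn (h : IsFrameOn L φ X U) (hL : L.IsImmersed)
    (hol : IsHolomorphicCurve R L) : ∃ S, IsAdaptedOn R L S U := by
  classical
  obtain ⟨JL, hJL⟩ := hol
  -- The frame as a global section of `L`, extended by `0`, as `smooth_J` requires.
  let s : ∀ q, L.fiber q := fun q => if hq : φ q ∈ L.fiber q then ⟨φ q, hq⟩ else 0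
  have hs : ∀ q (hq : q ∈ U), s q = ⟨φ q, h.mem hq⟩ := fun q hq => dif_pos (h.mem hq)
  let ψ : M → H2 := fun q => dSection φ q (X q)
  let χ : M → H2 := fun q => JL.J q (s q)
  let B : M → H2 →L[ℝ] H2 := fun q => ofColumns (φ q, ψ q)
  -- On `U`, `χ = φ n` has coordinates `(n, 0)` in the basis, so `τ = ψ n`. Written this way,
  -- smoothness needs no separate argument for `n`.
  let τ : M → H2 := fun q => ofColumns (ψ q, 0) (Ring.inverse (B q) (χ q))
  have hχ : ContMDiffOn (𝓡 2) 𝓘(ℝ, H2) ∞ χ U :=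
    JL.smooth_J U s h.isOpen (h.smooth.congr fun q hq => congrArg Subtype.val (hs q hq))
  have hψ : ContMDiffOn (𝓡 2) 𝓘(ℝ, H2) ∞ ψ U :=
    contMDiffOn_mfderiv_apply h.isOpen h.smooth h.smooth_field
  have hunit : ∀ q ∈ U, IsUnit (B q) := fun q hq => h.isUnit hL hq
  have hτ : ContMDiffOn (𝓡 2) 𝓘(ℝ, H2) ∞ τ U :=
    (contMDiff_ofColumns.comp_contMDiffOn (hψ.prodMk_space contMDiffOn_const)).clm_apply
      ((contMDiffOn_inverse_ofColumns h.smooth_columns hunit).clm_apply hχ)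
  have hn : ∀ q ∈ U, ∃ n : ℍ[ℝ]ᵐᵒᵖ, χ q = n • φ q ∧ τ q = n • ψ q := fun q hq => by
    obtain ⟨n, hn⟩ := h.exists_smul_eq hq (JL.J q (s q)).2
    refine ⟨n, hn.symm, ?_⟩
    have h1 := inverse_ofColumns_apply_smul (hunit q hq) n.unop 0
    rw [MulOpposite.op_unop, MulOpposite.op_zero, zero_smul, add_zero] at h1
    have h2 : τ q = ofColumns (ψ q, 0) (Ring.inverse (B q) (n • φ q)) := by rw [hn]
    rw [h2, h1, ofColumns_apply]
    simp
  let S : M → EndH := fun q => ⟨ofBasis (φ q, ψ q) (χ q, τ q), ofBasis_mem _ _⟩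
  have hSφ : ∀ q ∈ U, toLin (S q) (φ q) = χ q := fun q hq => ofBasis_apply_fst (hunit q hq) _
  have hSψ : ∀ q ∈ U, toLin (S q) (ψ q) = τ q := fun q hq => ofBasis_apply_snd (hunit q hq) _
  have hSL : ∀ q ∈ U, ∀ v : L.fiber q, toLin (S q) v = JL.J q v := fun q hq v => by
    obtain ⟨a, ha⟩ := h.exists_smul_eq hq v.2
    have hv : v = a • s q := by
      rw [hs q hq]
      exact Subtype.ext ha.symm
    rw [← ha, map_smul, hSφ q hq, hv, map_smul]
    rfl
  have hmem : ∀ q ∈ U, ∀ v ∈ L.fiber q, toLin (S q) v ∈ L.fiber q := fun q hq v hv => by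
    rw [hSL q hq ⟨v, hv⟩]
    exact (JL.J q _).2
  have hsq : ∀ q ∈ U, ∀ v, toLin (S q) (toLin (S q) v) = -v := fun q hq v => by
    obtain ⟨n, hχn, hτn⟩ := hn q hq
    have h1 : toLin (S q) (toLin (S q) (φ q)) = -φ q := by
      rw [hSL q hq ⟨φ q, h.mem hq⟩, hSL q hq, JL.J_sq]
      rfl
    -- `J_L² = -1` on `φ` gives `n² = -1`, which then yields `S² ψ = -ψ`.
    have h2 : n * n = -1 := by
      rw [hSφ q hq, hχn, map_smul, hSφ q hq, hχn, ← mul_smul, ← sub_eq_zero,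
        ← neg_one_smul ℍ[ℝ]ᵐᵒᵖ, ← sub_smul] at h1
      exact sub_eq_zero.1 ((smul_eq_zero.1 h1).resolve_right (h.ne_zero q hq))
    have h3 : toLin (S q) (toLin (S q) (ψ q)) = -ψ q := by
      rw [hSψ q hq, hτn, map_smul, hSψ q hq, hτn, ← mul_smul, h2, neg_one_smul]
    exact congrArg (fun A => A v) (eq_of_isUnit_ofColumns (hunit q hq)
      (A := toLin (S q) ∘ₗ toLin (S q)) (B := -LinearMap.id) h1 h3)
  refine ⟨S, h.isOpen, contMDiffOn_ofBasis h.smooth_columns (hχ.prodMk_space hτ) hunit,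
    fun q hq => Subtype.ext (ContinuousLinearMap.ext fun v => hsq q hq v), hmem,
    fun q hq Y v hv => ?_, fun q hq Y v w hw => ?_⟩
  · rw [hJL q Y, LinearMap.comp_apply]
    congr 1
    exact Subtype.ext (hSL q hq ⟨v, hv⟩).symm
  · have hA : L.fiber q ≤ (L.fiber q).comap (toLin (S q)) := fun v hv => hmem q hq v hv
    have key := conf_right_of_ne_zero (R := R) (hsq q hq) hA (h.field_ne_zero q hq) (by
      ext1 v
      obtain ⟨n, hχn, hτn⟩ := hn q hq
      obtain ⟨a, ha⟩ := h.exists_smul_eq hq v.2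
      have hv : v = a • s q := by
        rw [hs q hq]
        exact Subtype.ext ha.symm
      have hJ : JL.J q (s q) = n • s q := by
        refine Subtype.ext (hχn.trans ?_)
        rw [hs q hq]
        rfl
      rw [hJL q (X q), LinearMap.comp_apply, LinearMap.comp_apply, hv]
      simp only [map_smul, hJ]
      rw [hs q hq, h.delta_apply hq, Submodule.mkQ_apply, Submodule.mapQ_apply, hSψ q hq, hτn]
      rfl) Y
    rw [key, LinearMap.comp_apply, hw]
    rfl

end IsFrameOn

end Frames

/-! ### Correction of the Hopf field on `L`. -/

section Correction

variable {M : Type*} [TopologicalSpace M] [ChartedSpace (EuclideanSpace ℝ (Fin 2)) M]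
  [IsManifold (𝓡 2) ∞ M] {R : RiemannSurfaceStructure M} {L : LineSubbundle M}
  {S : M → EndH} {U : Set M}

namespace IsAdaptedOn

theorem hopfQ_mem (h : IsAdaptedOn R L S U) {p : M} (hp : p ∈ U) (X : TangentSpace (𝓡 2) p)
    {v : H2} (hv : v ∈ L.fiber p) : hopfQ R S p X v ∈ L.fiber p := by
  rw [hopfQ_apply_eq]
  exact Submodule.smul_of_tower_mem _ _ (Submodule.sub_mem _ (h.mem p hp _ (h.dEnd_mem hp X hv))
    (h.dEnd_mem hp _ hv))

theorem hopfQ_smul (h : IsAdaptedOn R L S U) {p : M} (hp : p ∈ U) (X : TangentSpace (𝓡 2) p)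
    (a : ℍ[ℝ]ᵐᵒᵖ) (v : H2) : hopfQ R S p X (a • v) = a • hopfQ R S p X v := by
  simp only [hopfQ_apply_eq, dEnd_smul (h.mdifferentiableAt hp), map_smul, ← smul_sub]
  rw [smul_comm]

/-- Inherited from `S dS = -dS S`. It is what makes the correction term anticommute with `S`. -/
theorem hopfQ_anticomm (h : IsAdaptedOn R L S U) {p : M} (hp : p ∈ U)
    (X : TangentSpace (𝓡 2) p) (v : H2) :
    hopfQ R S p X (toLin (S p) v) = -toLin (S p) (hopfQ R S p X v) := by
  have hsq : ∀ᶠ q in 𝓝 p, S q * S q = -1 :=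
    Filter.mem_of_superset (h.isOpen.mem_nhds hp) h.sq
  simp only [hopfQ_apply_eq, dEnd_anticomm (h.mdifferentiableAt hp) hsq, toLin_real_smul, map_neg,
    map_sub]
  module

/-- The Hopf field vanishes on `L_p` if it does so in one nonzero direction. -/
theorem hopfQ_eq_zero_of_ne_zero (h : IsAdaptedOn R L S U) {p : M} (hp : p ∈ U)
    {X : TangentSpace (𝓡 2) p} (hX : X ≠ 0) {v : H2} (h0 : hopfQ R S p X v = 0)
    (Y : TangentSpace (𝓡 2) p) : hopfQ R S p Y v = 0 := by
  obtain ⟨a, b, rfl⟩ := exists_eq_smul_add_smul_J R hX Y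
  rw [hopfQ_apply_eq_zero_iff] at h0 ⊢
  simp only [map_add, map_smul, R.J_sq, map_neg, add_apply, smul_apply, neg_apply, h0,
    toLin_real_smul, toLin_toLin_of_sq (h.sq p hp)]

end IsAdaptedOn

/-- An adapted complex structure can be corrected so that its Hopf field vanishes on `L`. -/
theorem IsFrameOn.exists_hopfQ_eq_zero {φ : M → H2} {X : ∀ q : M, TangentSpace (𝓡 2) q}
    (h : IsFrameOn L φ X U) (hL : L.IsImmersed) (hS : IsAdaptedOn R L S U) :
    ∃ T, IsAdaptedOn R L T U ∧
      ∀ p ∈ U, ∀ (Y : TangentSpace (𝓡 2) p), ∀ v ∈ L.fiber p, hopfQ R T p Y v = 0 := by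
  let ψ : M → H2 := fun q => dSection φ q (X q)
  -- The value of `D ψ` obtained by solving `Q_S(X) φ - ½ S D ψ = 0`.
  let w : M → H2 := fun q => (-2 : ℝ) • toLin (S q) (hopfQ R S q (X q) (φ q))
  have hunit : ∀ q ∈ U, IsUnit (ofColumns (φ q, ψ q)) := fun q hq => h.isUnit hL hq
  have hQ : ContMDiffOn (𝓡 2) 𝓘(ℝ, H2 →L[ℝ] H2) ∞ (fun q => hopfQ R S q (X q)) U := by
    have h1 : ContMDiffOn (𝓡 2) 𝓘(ℝ, H2 →L[ℝ] H2) ∞ (fun q => dEnd S q (X q)) U :=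
      contMDiffOn_mfderiv_apply h.isOpen hS.smooth h.smooth_field
    have h2 : ContMDiffOn (𝓡 2) 𝓘(ℝ, H2 →L[ℝ] H2) ∞ (fun q => dEnd S q (R.J q (X q))) U :=
      contMDiffOn_mfderiv_apply h.isOpen hS.smooth (h.smooth_J_field R)
    exact (contMDiffOn_const (I' := 𝓘(ℝ, ℝ)) (c := (1 / 4 : ℝ))).smul
      ((hS.smooth.clm_comp h1).sub h2)
  have hw : ContMDiffOn (𝓡 2) 𝓘(ℝ, H2) ∞ w U :=
    (contMDiffOn_const (I' := 𝓘(ℝ, ℝ)) (c := (-2 : ℝ))).smul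
      (hS.smooth.clm_apply (hQ.clm_apply h.smooth))
  have hwL : ∀ q ∈ U, w q ∈ L.fiber q := fun q hq =>
    Submodule.smul_of_tower_mem _ _ (hS.mem q hq _ (hS.hopfQ_mem hq _ (h.mem hq)))
  let D : M → EndH := fun q => ⟨ofBasis (φ q, ψ q) (0, w q), ofBasis_mem _ _⟩
  have hDφ : ∀ q ∈ U, toLin (D q) (φ q) = 0 := fun q hq => ofBasis_apply_fst (hunit q hq) _
  have hDψ : ∀ q ∈ U, toLin (D q) (ψ q) = w q := fun q hq => ofBasis_apply_snd (hunit q hq) _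
  have hDL : ∀ q ∈ U, ∀ v ∈ L.fiber q, toLin (D q) v = 0 := fun q hq v hv => by
    obtain ⟨a, rfl⟩ := h.exists_smul_eq hq hv
    rw [map_smul, hDφ q hq, smul_zero]
  have hDmem : ∀ q ∈ U, ∀ v, toLin (D q) v ∈ L.fiber q := fun q hq v => by
    have hv : toLin (D q) v = MulOpposite.op (Ring.inverse (ofColumns (φ q, ψ q)) v 0) • (0 : H2) +
      MulOpposite.op (Ring.inverse (ofColumns (φ q, ψ q)) v 1) • w q := rfl
    rw [hv, smul_zero, zero_add]
    exact Submodule.smul_mem _ _ (hwL q hq)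
  let T : M → EndH := fun q => S q + D q
  have hT : ∀ q v, toLin (T q) v = toLin (S q) v + toLin (D q) v := fun _ _ => rfl
  have hTL : ∀ q ∈ U, ∀ v ∈ L.fiber q, toLin (T q) v = toLin (S q) v := fun q hq v hv => by
    rw [hT, hDL q hq v hv, add_zero]
  -- Writing `S φ = φ n`, also `S ψ ≡ ψ n mod L`, so `D S ψ = w n = -2 S Q(S φ)`; moving `S` out of
  -- `Q` changes the sign.
  have hDS : ∀ q ∈ U, toLin (D q) (toLin (S q) (ψ q)) = -toLin (S q) (w q) := fun q hq => by
    obtain ⟨n, hn⟩ := h.exists_smul_eq hq (hS.mem q hq _ (h.mem hq))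
    have h1 : toLin (S q) (ψ q) - n • ψ q ∈ L.fiber q := by
      have e1 := hS.conf_right q hq (X q) _ _ (h.delta_apply hq (X q))
      have e2 := hS.conf_left q hq (X q) _ (h.mem hq)
      have e3 : (⟨toLin (S q) (φ q), hS.mem q hq _ (h.mem hq)⟩ : L.fiber q) =
          n • ⟨φ q, h.mem hq⟩ := Subtype.ext hn.symm
      rw [e1, e3, map_smul, h.delta_apply hq, ← map_smul, ← sub_eq_zero, ← map_sub] at e2
      exact (Submodule.Quotient.mk_eq_zero _).1 e2
    have h2 := hDL q hq _ h1
    rw [map_sub, map_smul, hDψ q hq, sub_eq_zero] at h2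
    have h3 : n • w q = (-2 : ℝ) • toLin (S q) (hopfQ R S q (X q) (toLin (S q) (φ q))) := by
      rw [← hn, hS.hopfQ_smul hq, map_smul, smul_comm]
    rw [h2, h3, hS.hopfQ_anticomm hq, map_neg, smul_neg, ← toLin_real_smul]
  have hsq : ∀ q ∈ U, ∀ v, toLin (T q) (toLin (T q) v) = -v := fun q hq v => by
    have hsS := toLin_toLin_of_sq (hS.sq q hq)
    have h1 : toLin (T q) (toLin (T q) (φ q)) = -φ q := by
      rw [hTL q hq _ (h.mem hq), hTL q hq _ (hS.mem q hq _ (h.mem hq)), hsS]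
    -- The cross terms `S D ψ` and `D S ψ` cancel, and `D² = 0` because `w` lies in `L`.
    have h2 : toLin (T q) (toLin (T q) (ψ q)) = -ψ q := by
      rw [hT q (ψ q), hDψ q hq, map_add, hTL q hq _ (hwL q hq), hT, hsS, hDS q hq]
      abel
    exact congrArg (fun A => A v) (eq_of_isUnit_ofColumns (hunit q hq)
      (A := toLin (T q) ∘ₗ toLin (T q)) (B := -LinearMap.id) h1 h2)
  have hTadapted : IsAdaptedOn R L T U := by
    refine ⟨h.isOpen, ?_, fun q hq => Subtype.ext (ContinuousLinearMap.ext fun v => hsq q hq v),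
      fun q hq v hv => ?_, fun q hq Y v hv => ?_, fun q hq Y v u hu => ?_⟩
    · exact hS.smooth.add (contMDiffOn_ofBasis h.smooth_columns
        (contMDiffOn_const.prodMk_space hw) hunit)
    · rw [hTL q hq v hv]
      exact hS.mem q hq v hv
    · rw [hS.conf_left q hq Y v hv]
      congr 1
      exact Subtype.ext (hTL q hq v hv).symm
    · rw [hS.conf_right q hq Y v u hu, hT, map_add, left_eq_add]
      exact (Submodule.Quotient.mk_eq_zero _).2 (hDmem q hq u)
  refine ⟨T, hTadapted, fun q hq Y v hv => ?_⟩
  obtain ⟨a, rfl⟩ := h.exists_smul_eq hq hv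
  rw [hTadapted.hopfQ_smul hq, hTadapted.hopfQ_eq_zero_of_ne_zero hq (h.field_ne_zero q hq) ?_ Y,
    smul_zero]
  have hφ := h.mdifferentiableAt hq
  -- Differentiate `T φ = S φ`, valid on all of `U`.
  have hd : ∀ Z : TangentSpace (𝓡 2) q,
      dEnd T q Z (φ q) = dEnd S q Z (φ q) - toLin (D q) (dSection φ q Z) := fun Z => by
    have h1 := dSection_toLin S φ q (hS.mdifferentiableAt hq) hφ Z
    have h2 := dSection_toLin T φ q (hTadapted.mdifferentiableAt hq) hφ Z
    have h3 : dSection (fun q => toLin (T q) (φ q)) q Z =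
        dSection (fun q => toLin (S q) (φ q)) q Z := by
      refine dSection_congr ?_ Z
      filter_upwards [h.isOpen.mem_nhds hq] with q' hq'
      exact hTL q' hq' _ (h.mem hq')
    rw [h1, h2, hT] at h3
    rw [eq_sub_iff_add_eq]
    exact add_right_cancel ((by abel : _ = _).trans h3)
  have hDJ : toLin (D q) (dSection φ q (R.J q (X q))) = -toLin (S q) (w q) := by
    rw [← hDS q hq, ← sub_eq_zero, ← map_sub]
    exact hDL q hq _ (hS.dSection_J_sub_mem hq hφ (h.eventually_mem hq) (X q))
  have hSw : toLin (S q) (w q) = (2 : ℝ) • hopfQ R S q (X q) (φ q) := by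
    rw [toLin_real_smul, toLin_toLin_of_sq (hS.sq q hq)]
    module
  have hψ : toLin (D q) (dSection φ q (X q)) = w q := hDψ q hq
  rw [hopfQ_apply_eq_zero_iff, hd, hd, hψ, hDJ,
    hTL q hq _ (Submodule.sub_mem _ (hS.dEnd_mem hq _ (h.mem hq)) (hwL q hq)), map_sub, hSw,
    hopfQ_apply_eq]
  module

/-! ### From local to global. -/

/-- Around every point there is a mean curvature sphere. -/
theorem exists_local_meanCurvatureSphere (hol : IsHolomorphicCurve R L) (hL : L.IsImmersed)
    (p : M) : ∃ (S : M → EndH) (U : Set M), p ∈ U ∧ IsAdaptedOn R L S U ∧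
      ∀ q ∈ U, ∀ (X : TangentSpace (𝓡 2) q), ∀ v ∈ L.fiber q, hopfQ R S q X v = 0 := by
  obtain ⟨φ, X, U, hp, h⟩ := exists_isFrameOn L p
  obtain ⟨S, hS⟩ := h.exists_isAdaptedOn hL hol
  obtain ⟨T, hT⟩ := h.exists_hopfQ_eq_zero hL hS
  exact ⟨T, U, hp, hT⟩

theorem IsMeanCurvatureSphere.isAdaptedOn (h : IsMeanCurvatureSphere R L S) :
    IsAdaptedOn R L S Set.univ where
  isOpen := isOpen_univ
  smooth := h.isComplexStructure.smooth.contMDiffOn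
  sq p _ := h.isComplexStructure.sq p
  mem p _ := Submodule.map_le_iff_le_comap.1 (h.map_eq p).le
  conf_left p _ X v hv := congrArg (fun A => A ⟨v, hv⟩) (h.conf_left p X)
  conf_right p _ X v w hw := by
    rw [h.conf_right p X, LinearMap.comp_apply, hw]
    rfl

theorem IsAdaptedOn.isMeanCurvatureSphere (h : IsAdaptedOn R L S Set.univ)
    (hQ : ∀ (p : M) (X : TangentSpace (𝓡 2) p), ∀ v ∈ L.fiber p, hopfQ R S p X v = 0) :
    IsMeanCurvatureSphere R L S := by
  have hmap : ∀ p, (L.fiber p).map (toLin (S p)) = L.fiber p := fun p => by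
    refine le_antisymm (Submodule.map_le_iff_le_comap.2 (h.mem p (Set.mem_univ p))) fun v hv => ?_
    refine ⟨-toLin (S p) v, Submodule.neg_mem _ (h.mem p (Set.mem_univ p) v hv), ?_⟩
    -- The preimage of `v` is `-S v`, as `S⁻¹ = -S`.
    rw [map_neg, toLin_toLin_of_sq (h.sq p (Set.mem_univ p)), neg_neg]
  refine ⟨⟨contMDiffOn_univ.1 h.smooth, fun p => h.sq p (Set.mem_univ p)⟩, hmap,
    fun p X _ hv => h.dEnd_mem (Set.mem_univ p) X hv, fun p X => ?_, fun p X => ?_, hQ⟩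
  · refine LinearMap.ext fun v => ?_
    exact h.conf_left p (Set.mem_univ p) X v v.2
  · refine LinearMap.ext fun v => ?_
    obtain ⟨w, hw⟩ := (L.fiber p).mkQ_surjective (L.delta p X v)
    rw [h.conf_right p (Set.mem_univ p) X v w hw.symm, LinearMap.comp_apply, ← hw,
      Submodule.mkQ_apply, Submodule.mkQ_apply, Submodule.mapQ_apply]

end Correction

end QuaternionicCurve

end

open QuaternionicCurve in
theorem mainTheorem1 {M : Type*} [TopologicalSpace M]
    [ChartedSpace (EuclideanSpace ℝ (Fin 2)) M] [IsManifold (𝓡 2) ∞ M]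
    (R : QuaternionicCurve.RiemannSurfaceStructure M)
    (L : QuaternionicCurve.LineSubbundle M)
    (hL : QuaternionicCurve.IsHolomorphicCurve R L)
    (hL' : L.IsImmersed) :
    ∃! S : M → QuaternionicCurve.EndH, QuaternionicCurve.IsMeanCurvatureSphere R L S := by
  choose T U hp hT hQ using exists_local_meanCurvatureSphere hL hL'
  -- The diagonal of the chosen local solutions. By local uniqueness it agrees with `T p` on all of
  -- `U p`, so smoothness and `Q` can be computed from `T p`.
  let S : M → EndH := fun p => T p p
  have hST : ∀ p, ∀ q ∈ U p, S q = T p q := fun p q hq =>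
    (hT q).eq_of_hopfQ_eq_zero hL' (hT p) (hQ q) (hQ p) (hp q) hq
  have hev : ∀ p, S =ᶠ[𝓝 p] T p := fun p =>
    Filter.mem_of_superset ((hT p).isOpen.mem_nhds (hp p)) (hST p)
  have hS : IsAdaptedOn R L S Set.univ :=
    { isOpen := isOpen_univ
      smooth := contMDiffOn_univ.2 fun p =>
        ((hT p).smooth.contMDiffAt ((hT p).isOpen.mem_nhds (hp p))).congr_of_eventuallyEq
          ((hev p).fun_comp Subtype.val)
      sq := fun p _ => (hT p).sq p (hp p)
      mem := fun p _ => (hT p).mem p (hp p)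
      conf_left := fun p _ => (hT p).conf_left p (hp p)
      conf_right := fun p _ => (hT p).conf_right p (hp p) }
  have hQS : ∀ (p : M) (X : TangentSpace (𝓡 2) p), ∀ v ∈ L.fiber p, hopfQ R S p X v = 0 := by
    intro p X v hv
    have h := hQ p p (hp p) X v hv
    rw [hopfQ_apply_eq_zero_iff] at h ⊢
    rw [dEnd_congr (hev p), dEnd_congr (hev p)]
    exact h
  refine ⟨S, hS.isMeanCurvatureSphere hQS, fun S' hS' => funext fun p => ?_⟩
  exact hS'.isAdaptedOn.eq_of_hopfQ_eq_zero hL' hS (fun p _ => hS'.hopfQ_eq_zero p)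
    (fun p _ => hQS p) trivial trivial
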